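/- Let $A$ be a (not necessarily unital) $C^*$-algebra and let $\mathrm{Prim}(A)$ be the set of primitive ideals of $A$ (kernels of nonzero irreducible $*$-representations on Hilbert spaces) with the hull-kernel topology. For $P,Q\in\mathrm{Prim}(A)$ write $P\approx Q$ if $f(P)=f(Q)$ for every bounded continuous function $f:\mathrm{Prim}(A)\to\mathbb{R}$. For $P\in\mathrm{Prim}(A)$ let $q_A(P)=\bigcap\{Q\in\mathrm{Prim}(A) : Q\approx P\}$, and let $\mathrm{Glimm}(A)=\{q_A(P) : P\in\mathrm{Prim}(A)\}$, which is naturally identified with $\mathrm{Prim}(A)/{\approx}$. Let $\tau_q$ be the quotient topology on $\mathrm{Glimm}(A)$ induced by $q_A$, and let $\tau_{cr}$ be the weakest topology on $\mathrm{Glimm}(A)$ for which every function $g:\mathrm{Glimm}(A)\to\mathbb{R}$ with $g\circ q_A$ bounded and continuous on $\mathrm{Prim}(A)$ is continuous. For $a\in A$ and $G\in\mathrm{Glimm}(A)$ let $\|a+G\|$ be the quotient norm in $A/G$. Compactness means that every open cover has a finite subcover; no separation axiom is included. Let $K$ be a $\tau_{cr}$-compact subset of $\mathrm{Glimm}(A)$.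 There are $a\in A$ and $\alpha>0$ such that $K\subset\{G\in\mathrm{Glimm}(A) : \|a+G\|\ge\alpha\}$ if and only if there is a compact subset $C\subset\mathrm{Prim}(A)$ such that $q_A(C)=K$. Moreover, a $\tau_{cr}$-compact set $K$ that satisfies these equivalent conditions is also $\tau_q$-compact. -/

import Mathlib

universe u

open scoped BoundedContinuousFunction

/-- A *-representation `π` of `A` on a Hilbert space `H` is (topologically) irreducible if it is
nonzero and the only closed invariant subspaces of `H` are `0` and `H`. -/
def IsIrreducibleRep {A H : Type*} [NonUnitalCStarAlgebra A] [NormedAddCommGroup H]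
    [InnerProductSpace ℂ H] [CompleteSpace H] (π : A →⋆ₙₐ[ℂ] (H →L[ℂ] H)) : Prop :=
  π ≠ 0 ∧ ∀ M : Submodule ℂ H, IsClosed (M : Set H) → (∀ a : A, ∀ ξ ∈ M, π a ξ ∈ M) →
    M = ⊥ ∨ M = ⊤

/-- A primitive ideal is the kernel of an irreducible *-representation. An irreducible
representation is cyclic, so its Hilbert space is the closure of an image of `A`, and it suffices
to take Hilbert spaces in the universe of `A`. -/
def IsPrimitiveIdeal {A : Type u} [NonUnitalCStarAlgebra A] (P : TwoSidedIdeal A) : Prop :=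
  ∃ (H : Type u) (_ : NormedAddCommGroup H) (_ : InnerProductSpace ℂ H) (_ : CompleteSpace H)
    (π : A →⋆ₙₐ[ℂ] (H →L[ℂ] H)), IsIrreducibleRep π ∧ ∀ a : A, a ∈ P ↔ π a = 0

/-- The set `Prim(A)` of primitive ideals. -/
def PrimSpace (A : Type u) [NonUnitalCStarAlgebra A] : Type u :=
  {P : TwoSidedIdeal A // IsPrimitiveIdeal P}

section PrimSpace

variable {A : Type u} [NonUnitalCStarAlgebra A]

theorem IsPrimitiveIdeal.ne_top {P : TwoSidedIdeal A} (hP : IsPrimitiveIdeal P) : P ≠ ⊤ := by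
  obtain ⟨H, _, _, _, π, hπ, hk⟩ := hP
  rintro rfl
  exact hπ.1 (by ext1 a; exact (hk a).1 trivial)

/-- Primitive ideals are prime. -/
theorem IsPrimitiveIdeal.prime {P : TwoSidedIdeal A} (hP : IsPrimitiveIdeal P)
    {I J : TwoSidedIdeal A} (h : I ⊓ J ≤ P) : I ≤ P ∨ J ≤ P := by
  obtain ⟨H, _, _, _, π, hπ, hk⟩ := hP
  by_contra! hcon
  obtain ⟨hI, hJ⟩ := hcon
  obtain ⟨i, hi, hiP⟩ := Set.not_subset.1 hI
  obtain ⟨j, hj, hjP⟩ := Set.not_subset.1 hJ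
  have hi0 : ¬ π i = 0 := fun h0 => hiP ((hk i).2 h0)
  have hj0 : ¬ π j = 0 := fun h0 => hjP ((hk j).2 h0)
  -- the closed invariant subspace of vectors killed by `π (i * a)` for every `a` and by `π i`
  let M : Submodule ℂ H :=
    { carrier := {ξ | π i ξ = 0 ∧ ∀ a, π (i * a) ξ = 0}
      add_mem' := by
        rintro x y ⟨hx, hx'⟩ ⟨hy, hy'⟩
        exact ⟨by simp [hx, hy], fun a => by rw [map_add, hx', hy', add_zero]⟩
      zero_mem' := by simp
      smul_mem' := by
        rintro c x ⟨hx, hx'⟩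
        exact ⟨by simp [hx], fun a => by rw [map_smul, hx', smul_zero]⟩ }
  have hMc : IsClosed (M : Set H) := by
    have : (M : Set H) = {ξ | π i ξ = 0} ∩ ⋂ a, {ξ | π (i * a) ξ = 0} := by
      ext ξ; simp [M]
    rw [this]
    exact (isClosed_eq (π i).continuous continuous_const).inter
      (isClosed_iInter fun a => isClosed_eq (π (i * a)).continuous continuous_const)
  have hMi : ∀ a : A, ∀ ξ ∈ M, π a ξ ∈ M := by
    rintro a ξ ⟨_, h2⟩
    refine ⟨?_, fun b => ?_⟩
    · simpa using h2 a
    · have := h2 (b * a)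
      rw [← mul_assoc, map_mul] at this
      exact this
  have hjM : ∀ ξ, π j ξ ∈ M := by
    intro ξ
    have key : ∀ x, x ∈ I → π x (π j ξ) = 0 := by
      intro x hx
      have h1 : x * j ∈ P := h ((TwoSidedIdeal.mem_inf A).2
        ⟨I.mul_mem_right x j hx, J.mul_mem_left x j hj⟩)
      have h2 := (hk _).1 h1
      rw [map_mul] at h2
      exact DFunLike.congr_fun h2 ξ
    exact ⟨key i hi, fun a => key _ (I.mul_mem_right i a hi)⟩
  rcases hπ.2 M hMc hMi with hM | hM
  · apply hj0
    ext ξ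
    have := hjM ξ
    rw [hM] at this
    simpa using this
  · apply hi0
    ext ξ
    have : ξ ∈ M := by rw [hM]; trivial
    exact this.1

/-- The hull of a two-sided ideal: the primitive ideals containing it. -/
def idealHull (I : TwoSidedIdeal A) : Set (PrimSpace A) := {P | I ≤ P.1}

/-- The hull-kernel (Jacobson) topology on `Prim(A)`: the closed sets are the hulls of ideals. -/
instance : TopologicalSpace (PrimSpace A) :=
  TopologicalSpace.ofClosed (Set.range idealHull)
    ⟨⊤, by
      ext P
      simpa [idealHull] using P.2.ne_top⟩
    (by
      intro S hS
      refine ⟨sSup {I | idealHull I ∈ S}, ?_⟩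
      ext P
      simp only [idealHull, Set.mem_ofPred_eq, sSup_le_iff, Set.mem_sInter]
      constructor
      · intro h t ht
        obtain ⟨I, rfl⟩ := hS ht
        exact h I ht
      · intro h I hI
        exact h _ hI)
    (by
      rintro _ ⟨I, rfl⟩ _ ⟨J, rfl⟩
      refine ⟨I ⊓ J, ?_⟩
      ext P
      constructor
      · exact fun h => P.2.prime h
      · rintro (h | h)
        · exact le_trans inf_le_left (show I ≤ P.1 from h)
        · exact le_trans inf_le_right (show J ≤ P.1 from h))

/-- `P ≈ Q`: no bounded continuous real function on `Prim(A)` separates `P` and `Q`. -/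
def primEquiv (P Q : PrimSpace A) : Prop := ∀ f : PrimSpace A →ᵇ ℝ, f P = f Q

/-- The kernel (intersection) of the equivalence class of `P`. -/
noncomputable def glimmIdeal (P : PrimSpace A) : TwoSidedIdeal A :=
  sInf {I | ∃ Q : PrimSpace A, primEquiv P Q ∧ Q.1 = I}

end PrimSpace

/-- `Glimm(A)`: the set of kernels of equivalence classes in `Prim(A)`. -/
def GlimmSpace (A : Type u) [NonUnitalCStarAlgebra A] : Type u :=
  {G : TwoSidedIdeal A // ∃ P : PrimSpace A, glimmIdeal P = G}

/-- The quotient map `q_A : Prim(A) → Glimm(A)`. -/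
noncomputable def glimmMap (A : Type u) [NonUnitalCStarAlgebra A] (P : PrimSpace A) :
    GlimmSpace A :=
  ⟨glimmIdeal P, P, rfl⟩

/-- The quotient topology on `Glimm(A)`. -/
@[reducible]
noncomputable def tauQ (A : Type u) [NonUnitalCStarAlgebra A] : TopologicalSpace (GlimmSpace A) :=
  TopologicalSpace.coinduced (glimmMap A) inferInstance

/-- The weakest topology on `Glimm(A)` making continuous all the functions `g` obtained by dropping
to `Glimm(A)` a bounded continuous real function `f` on `Prim(A)`, that is, `g ∘ q_A = f`. -/
@[reducible]
noncomputable def tauCR (A : Type u) [NonUnitalCStarAlgebra A] : TopologicalSpace (GlimmSpace A) :=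
  ⨅ (g : GlimmSpace A → ℝ) (_ : ∃ f : PrimSpace A →ᵇ ℝ, ∀ P, g (glimmMap A P) = f P),
    TopologicalSpace.induced g inferInstance

/-- The quotient norm `‖a + G‖` in `A / G`. -/
noncomputable def cosetNorm {A : Type u} [NonUnitalCStarAlgebra A] (a : A) (G : TwoSidedIdeal A) :
    ℝ :=
  ‖(QuotientAddGroup.mk a : A ⧸ AddSubgroup.ofClass G)‖

/-!
Both implications rest on two topological properties of the function `P ↦ ‖a + P‖` on `Prim(A)`.

It is lower semicontinuous, and `‖a + ⋂ P‖ = sup ‖a + P‖`: cutting the singular values of `a` down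
to `t` changes `a` by an element that lies in every primitive ideal `P` with `‖a + P‖ ≤ t`.

The sets `{P | ‖a + P‖ ≥ β}` with `β > 0` are compact. Each `P` carries a quasi-state `φ` that
vanishes on `P` and satisfies `φ(a⋆a) = ‖a + P‖²`. Along an ultrafilter on such a set, the
quasi-states have a weak-* limit `ψ` with `ψ(a⋆a) ≥ β²` that vanishes on the ideal of the elements
eventually lying in `P`. Vanishing on an ideal cuts out a face of the quasi-states, so by the
Krein-Milman theorem `ψ` may be replaced by an extreme quasi-state without decreasing its value at
`a⋆a`. Its GNS representation is irreducible, and the kernel is a limit of the ultrafilter.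

If `‖a + G‖ ≥ α` on `K`, then `{P | ‖a + P‖ ≥ α / 2}` maps onto a set containing `K`; its
intersection with the preimage of `K`, which is closed as `τ_cr` is Hausdorff, is the desired
compact set. Conversely, a compact `C` is covered by finitely many open sets `{P | ‖aᵢ + P‖ > 1}`,
and `∑ aᵢ⋆aᵢ` has norm at least `1` modulo every `P ∈ C`.
-/

section NormExcess

open scoped CStarAlgebra

variable {A : Type*} [NonUnitalCStarAlgebra A]

/-- The part of `a` that is removed when its singular values are cut down to at most `t`: in terms
of the polar decomposition `a = u * |a|` it is `u * (|a| - t)⁺`. The scalar function is written with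
`√|x|` so that its estimates hold for every real `x`, not only on the spectrum of `star a * a`. -/
noncomputable def normExcess (t : ℝ) (a : A) : A :=
  a * cfcₙ (fun x : ℝ => 1 - t / max t √|x|) (star a * a)

theorem continuous_one_sub_div_max_sqrt_abs {t : ℝ} (ht : 0 < t) :
    Continuous fun x : ℝ => 1 - t / max t √|x| :=
  continuous_const.sub <| continuous_const.div (by fun_prop) fun _ =>
    (lt_max_of_lt_left ht).ne'

theorem star_mul_self_sub_mul_cfcₙ (a : A) {g : ℝ → ℝ} (hg : Continuous g) (hg0 : g 0 = 0) :
    star (a - a * cfcₙ g (star a * a)) * (a - a * cfcₙ g (star a * a)) =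
      cfcₙ (fun x => x * (1 - g x) ^ 2) (star a * a) := by
  have hself : IsSelfAdjoint (star a * a) := .star_mul_self a
  have hstar : star (cfcₙ g (star a * a)) = cfcₙ g (star a * a) :=
    (cfcₙ_predicate g (star a * a) : IsSelfAdjoint _).star_eq
  have hfun : (fun x => x * (1 - g x) ^ 2) = fun x => x - x * g x - g x * (x - x * g x) := by
    ext x; ring
  rw [hfun, cfcₙ_sub (fun x => x - x * g x) (fun x => g x * (x - x * g x)),
    cfcₙ_mul g (fun x => x - x * g x), cfcₙ_sub (fun x => x) (fun x => x * g x),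
    cfcₙ_mul (fun x => x) g, cfcₙ_id' ℝ (star a * a), star_sub, star_mul, hstar]
  noncomm_ring

theorem norm_sub_normExcess_le {t : ℝ} (ht : 0 < t) (a : A) : ‖a - normExcess t a‖ ≤ t := by
  refine le_of_sq_le_sq ?_ ht.le
  rw [sq, ← CStarRing.norm_star_mul_self, normExcess, star_mul_self_sub_mul_cfcₙ a
    (continuous_one_sub_div_max_sqrt_abs ht) (by simp [max_eq_left ht.le, ht.ne'])]
  refine norm_cfcₙ_le fun x _ => ?_
  have hmax : 0 < max t √|x| := lt_max_of_lt_left ht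
  have hx : |x| ≤ max t √|x| ^ 2 := by
    calc |x| = √|x| ^ 2 := (Real.sq_sqrt (abs_nonneg x)).symm
      _ ≤ max t √|x| ^ 2 := by gcongr; exact le_max_right _ _
  rw [sub_sub_cancel, Real.norm_eq_abs, abs_mul, abs_of_nonneg (sq_nonneg (t / _)), div_pow,
    mul_div_assoc', div_le_iff₀ (pow_pos hmax 2), mul_comm]
  gcongr

theorem map_normExcess_eq_zero {B : Type*} [NonUnitalCStarAlgebra B] (π : A →⋆ₙₐ[ℂ] B) {t : ℝ}
    (ht : 0 < t) {a : A} (ha : ‖π a‖ ≤ t) : π (normExcess t a) = 0 := by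
  have hcont := continuous_one_sub_div_max_sqrt_abs ht
  have hvanish : cfcₙ (fun x : ℝ => 1 - t / max t √|x|) (star (π a) * π a) = 0 := by
    rw [← cfcₙ_const_zero ℝ (star (π a) * π a)]
    refine cfcₙ_congr fun x hx => ?_
    have hx : |x| ≤ ‖π a‖ * ‖π a‖ := by
      rw [← CStarRing.norm_star_mul_self]
      exact NonUnitalIsometricContinuousFunctionalCalculus.norm_quasispectrum_le _ hx
    have hxt : √|x| ≤ t := Real.sqrt_le_iff.2 ⟨ht.le, hx.trans (by rw [sq]; gcongr)⟩
    simp [max_eq_left hxt, ht.ne']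
  rw [normExcess, map_mul, NonUnitalStarAlgHomClass.map_cfcₙ π _ (star a * a) hcont.continuousOn
    (by simp [max_eq_left ht.le, ht.ne']) (map_continuous π) (.star_mul_self a)
    (by rw [map_mul, map_star]; exact .star_mul_self _), map_mul, map_star, hvanish, mul_zero]

end NormExcess

section QuasiStates

open scoped ComplexOrder

variable {A : Type*} [NonUnitalCStarAlgebra A]

/-- The quasi-states of `A`, that is, the positive functionals of norm at most `1`. The single
inequality `|φ a| ^ 2 ≤ φ (star a * a)` expresses both conditions without referring to a unit, and
it is visibly preserved under weak-* limits. -/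
def quasiStates (A : Type*) [NonUnitalCStarAlgebra A] : Set (WeakDual ℂ A) :=
  {φ | ∀ a, ((‖φ a‖ ^ 2 : ℝ) : ℂ) ≤ φ (star a * a)}

/-- The quasi-states of `A` that come from the quotient of `A` by an ideal. -/
def quasiStatesVanishingOn (I : TwoSidedIdeal A) : Set (WeakDual ℂ A) :=
  {φ ∈ quasiStates A | ∀ x ∈ I, φ x = 0}

theorem norm_sq_le_re_of_mem_quasiStates {φ : WeakDual ℂ A} (hφ : φ ∈ quasiStates A) (a : A) :
    ‖φ a‖ ^ 2 ≤ (φ (star a * a)).re :=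
  (Complex.le_def.1 (hφ a)).1

theorem nonneg_of_mem_quasiStates {φ : WeakDual ℂ A} (hφ : φ ∈ quasiStates A) (a : A) :
    0 ≤ φ (star a * a) :=
  le_trans (by exact_mod_cast sq_nonneg ‖φ a‖) (hφ a)

theorem zero_mem_quasiStates : (0 : WeakDual ℂ A) ∈ quasiStates A := fun a =>
  le_of_eq (by simp [show ∀ b, (0 : WeakDual ℂ A) b = 0 from fun _ => rfl])

theorem norm_toStrongDual_le_one_of_mem_quasiStates {φ : WeakDual ℂ A} (hφ : φ ∈ quasiStates A) :
    ‖WeakDual.toStrongDual φ‖ ≤ 1 := by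
  set N := ‖WeakDual.toStrongDual φ‖
  have hN : 0 ≤ N := norm_nonneg _
  have hbound : N ≤ √N := by
    refine ContinuousLinearMap.opNorm_le_bound _ (Real.sqrt_nonneg _) fun a => ?_
    refine le_of_sq_le_sq ?_ (by positivity)
    calc ‖φ a‖ ^ 2 ≤ (φ (star a * a)).re := norm_sq_le_re_of_mem_quasiStates hφ a
      _ ≤ ‖φ (star a * a)‖ := Complex.re_le_norm _
      _ ≤ N * ‖star a * a‖ := (WeakDual.toStrongDual φ).le_opNorm _
      _ = (√N * ‖a‖) ^ 2 := by
        rw [CStarRing.norm_star_mul_self, mul_pow, Real.sq_sqrt hN, sq]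
  nlinarith [Real.sq_sqrt hN, Real.sqrt_nonneg N]

theorem isClosed_quasiStates : IsClosed (quasiStates A) := by
  simp only [quasiStates, Set.ofPred_forall]
  exact isClosed_iInter fun a => isClosed_le
    (Complex.continuous_ofReal.comp ((WeakDual.eval_continuous a).norm.pow 2))
    (WeakDual.eval_continuous _)

theorem isCompact_quasiStates : IsCompact (quasiStates A) :=
  (WeakDual.isCompact_closedBall (𝕜 := ℂ) (E := A) 0 1).of_isClosed_subset isClosed_quasiStates
    fun _ hφ => mem_closedBall_zero_iff.2 (norm_toStrongDual_le_one_of_mem_quasiStates hφ)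

theorem isCompact_quasiStatesVanishingOn (I : TwoSidedIdeal A) :
    IsCompact (quasiStatesVanishingOn I) := by
  refine isCompact_quasiStates.inter_right (t := {φ : WeakDual ℂ A | ∀ x ∈ I, φ x = 0}) ?_
  simp only [Set.ofPred_forall]
  exact isClosed_biInter fun x _ => isClosed_eq (WeakDual.eval_continuous x) continuous_const

theorem isExtreme_quasiStatesVanishingOn (I : TwoSidedIdeal A) :
    IsExtreme ℝ (quasiStates A) (quasiStatesVanishingOn I) := by
  refine ⟨fun φ hφ => hφ.1, ?_⟩
  rintro φ₁ hφ₁ φ₂ hφ₂ φ hφ ⟨s, t, hs, ht, -, rfl⟩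
  refine ⟨hφ₁, fun x hx => ?_⟩
  have hsum : s * (φ₁ (star x * x)).re + t * (φ₂ (star x * x)).re = 0 := by
    rw [← Complex.re_ofReal_mul, ← Complex.re_ofReal_mul, ← Complex.add_re]
    exact congrArg Complex.re (hφ.2 _ (I.mul_mem_left (star x) x hx))
  have h₁ := norm_sq_le_re_of_mem_quasiStates hφ₁ x
  have h₂ := (Complex.le_def.1 (nonneg_of_mem_quasiStates hφ₂ x)).1
  rw [Complex.zero_re] at h₂
  have : ‖φ₁ x‖ ^ 2 ≤ 0 := by
    refine h₁.trans (nonpos_of_mul_nonpos_right ?_ hs)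
    nlinarith
  simpa using this

/-- The functional `φ ↦ Re φ(a)`, whose maximizers on a compact set of functionals form an exposed
face. -/
noncomputable def reEval (a : A) : StrongDual ℝ (WeakDual ℂ A) where
  toFun φ := (φ a).re
  map_add' _ _ := Complex.add_re _ _
  map_smul' t _ := Complex.re_ofReal_mul t _
  cont := Complex.continuous_re.comp (WeakDual.eval_continuous a)

theorem exists_mem_extremePoints_quasiStates {I : TwoSidedIdeal A} {ψ : WeakDual ℂ A}
    (hψ : ψ ∈ quasiStatesVanishingOn I) (a : A) :
    ∃ φ ∈ (quasiStates A).extremePoints ℝ, φ ∈ quasiStatesVanishingOn I ∧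
      (ψ (star a * a)).re ≤ (φ (star a * a)).re := by
  have : LocallyConvexSpace ℝ (WeakDual ℂ A) := WeakBilin.locallyConvexSpace
  let l := reEval (star a * a)
  let F := l.toExposed (quasiStatesVanishingOn I)
  have hF : IsExposed ℝ (quasiStatesVanishingOn I) F := ContinuousLinearMap.toExposed.isExposed
  have hcompact := isCompact_quasiStatesVanishingOn I
  obtain ⟨χ, hχ, hmax⟩ := hcompact.exists_isMaxOn ⟨ψ, hψ⟩ l.continuous.continuousOn
  obtain ⟨φ, hφ⟩ := (hF.isCompact hcompact).extremePoints_nonempty ⟨χ, hχ, fun ω hω => hmax hω⟩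
  exact ⟨φ, ((isExtreme_quasiStatesVanishingOn I).trans
    hF.isExtreme).extremePoints_subset_extremePoints hφ, hφ.1.1, hφ.1.2 ψ hψ⟩

end QuasiStates

section VectorFunctionals

open scoped ComplexOrder InnerProductSpace CStarAlgebra

variable {A : Type*} [NonUnitalCStarAlgebra A] {H : Type*} [NormedAddCommGroup H]
  [InnerProductSpace ℂ H] [CompleteSpace H] (π : A →⋆ₙₐ[ℂ] (H →L[ℂ] H))

/-- The functional `a ↦ ⟪v, π a v⟫` attached to a vector `v`. -/
noncomputable def vectorFunctional (v : H) : WeakDual ℂ A :=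
  StrongDual.toWeakDual <| innerSL ℂ v ∘L ContinuousLinearMap.apply ℂ H v ∘L
    (⟨(π : A →ₗ[ℂ] H →L[ℂ] H), map_continuous π⟩ : A →L[ℂ] H →L[ℂ] H)

theorem vectorFunctional_apply (v : H) (a : A) : vectorFunctional π v a = ⟪v, π a v⟫_ℂ := rfl

theorem inner_map_star_left (a : A) (v w : H) : ⟪π (star a) v, w⟫_ℂ = ⟪v, π a w⟫_ℂ := by
  rw [map_star, ContinuousLinearMap.star_eq_adjoint, ContinuousLinearMap.adjoint_inner_left]

theorem inner_map_left (a : A) (v w : H) : ⟪π a v, w⟫_ℂ = ⟪v, π (star a) w⟫_ℂ := by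
  rw [← inner_map_star_left, star_star]

theorem vectorFunctional_star_mul_self (v : H) (a : A) :
    vectorFunctional π v (star a * a) = ((‖π a v‖ ^ 2 : ℝ) : ℂ) := by
  rw [vectorFunctional_apply, map_mul, mul_apply_eq_comp, ← inner_map_left,
    inner_self_eq_norm_sq_to_K]
  norm_cast

theorem vectorFunctional_mem_quasiStates {v : H} (hv : ‖v‖ ≤ 1) :
    vectorFunctional π v ∈ quasiStates A := fun a => by
  rw [vectorFunctional_star_mul_self, Complex.real_le_real]
  gcongr
  calc ‖⟪v, π a v⟫_ℂ‖ ≤ ‖v‖ * ‖π a v‖ := norm_inner_le_norm _ _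
    _ ≤ ‖π a v‖ := mul_le_of_le_one_left (norm_nonneg _) hv

theorem exists_mem_quasiStatesVanishingOn_norm_sq_le {I : TwoSidedIdeal A}
    (hI : ∀ x ∈ I, π x = 0) (a : A) :
    ∃ φ ∈ quasiStatesVanishingOn I, ‖π a‖ ^ 2 ≤ (φ (star a * a)).re := by
  have hmem : ∀ v : H, ‖v‖ ≤ 1 → vectorFunctional π v ∈ quasiStatesVanishingOn I := fun v hv =>
    ⟨vectorFunctional_mem_quasiStates π hv, fun x hx => by simp [vectorFunctional_apply, hI x hx]⟩
  obtain ⟨φ, hφ, hmax⟩ := (isCompact_quasiStatesVanishingOn I).exists_isMaxOn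
    ⟨_, hmem 0 (by simp)⟩ (reEval (star a * a)).continuous.continuousOn
  have hre : 0 ≤ (φ (star a * a)).re := (Complex.le_def.1 (nonneg_of_mem_quasiStates hφ.1 a)).1
  refine ⟨φ, hφ, (Real.le_sqrt (norm_nonneg _) hre).1 ?_⟩
  refine ContinuousLinearMap.opNorm_le_of_unit_norm (Real.sqrt_nonneg _) fun v hv => ?_
  refine Real.le_sqrt_of_sq_le ?_
  calc ‖π a v‖ ^ 2 = (vectorFunctional π v (star a * a)).re := by
        rw [vectorFunctional_star_mul_self, Complex.ofReal_re]
    _ ≤ (φ (star a * a)).re := hmax (hmem v hv.le)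

end VectorFunctionals

section GNS

open scoped ComplexOrder InnerProductSpace CStarAlgebra

theorem exists_inner_eq_of_norm_le {𝕜 E H : Type*} [RCLike 𝕜] [AddCommGroup E] [Module 𝕜 E]
    [NormedAddCommGroup H] [InnerProductSpace 𝕜 H] [CompleteSpace H] {ι : E →ₗ[𝕜] H}
    (hι : DenseRange ι) (l : E →ₗ[𝕜] 𝕜) {C : ℝ} (hC : 0 ≤ C) (hl : ∀ x, ‖l x‖ ≤ C * ‖ι x‖) :
    ∃ ξ : H, ‖ξ‖ ≤ C ∧ ∀ x, ⟪ξ, ι x⟫_𝕜 = l x := by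
  refine ⟨(InnerProductSpace.toDual 𝕜 H).symm (l.extendOfNorm ι), ?_, fun x => ?_⟩
  · rw [LinearIsometryEquiv.norm_map]
    exact LinearMap.opNorm_extendOfNorm_le hι hC hl
  · rw [InnerProductSpace.toDual_symm_apply]
    exact LinearMap.extendOfNorm_eq hι ⟨C, hl⟩ x

theorem exists_gns_representation {A : Type u} [NonUnitalCStarAlgebra A] (φ : A →ₗ[ℂ] ℂ)
    (hφ : ∀ a, 0 ≤ φ (star a * a)) :
    ∃ (H : Type u) (_ : NormedAddCommGroup H) (_ : InnerProductSpace ℂ H) (_ : CompleteSpace H)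
      (π : A →⋆ₙₐ[ℂ] (H →L[ℂ] H)) (ι : A →ₗ[ℂ] H), DenseRange ι ∧
        (∀ a b, π a (ι b) = ι (a * b)) ∧ ∀ a b, ⟪ι a, ι b⟫_ℂ = φ (star a * b) := by
  let := CStarAlgebra.spectralOrder A
  have := CStarAlgebra.spectralOrderedRing A
  let f : A →ₚ[ℂ] ℂ := PositiveLinearMap.mk₀ φ fun x hx => by
    obtain ⟨y, rfl⟩ := CStarAlgebra.nonneg_iff_eq_star_mul_self.1 hx
    exact hφ y
  exact ⟨f.GNS, inferInstance, inferInstance, inferInstance, f.gnsNonUnitalStarAlgHom,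
    UniformSpace.Completion.toComplL.toLinearMap ∘ₗ f.toPreGNS.toLinearMap,
    UniformSpace.Completion.denseRange_coe.comp f.toPreGNS.surjective.denseRange
      (UniformSpace.Completion.continuous_coe _),
    fun _ _ => f.gnsNonUnitalStarAlgHom_apply_coe,
    fun _ _ => UniformSpace.Completion.inner_coe _ _⟩

theorem exists_cyclic_vectorFunctional_eq {A : Type u} [NonUnitalCStarAlgebra A]
    {φ : WeakDual ℂ A} (hφ : φ ∈ quasiStates A) :
    ∃ (H : Type u) (_ : NormedAddCommGroup H) (_ : InnerProductSpace ℂ H) (_ : CompleteSpace H)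
      (π : A →⋆ₙₐ[ℂ] (H →L[ℂ] H)) (ξ : H), ‖ξ‖ ≤ 1 ∧ (DenseRange fun a => π a ξ) ∧
        vectorFunctional π ξ = φ := by
  obtain ⟨H, _, _, _, π, ι, hι, hπι, hinner⟩ :=
    exists_gns_representation (φ : A →ₗ[ℂ] ℂ) (nonneg_of_mem_quasiStates hφ)
  have hbound (a : A) : ‖φ a‖ ≤ 1 * ‖ι a‖ := by
    refine le_of_sq_le_sq ?_ (by positivity)
    rw [one_mul, norm_sq_eq_re_inner (𝕜 := ℂ) (ι a), hinner]
    exact norm_sq_le_re_of_mem_quasiStates hφ a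
  obtain ⟨ξ, hξ_norm, hξ⟩ := exists_inner_eq_of_norm_le hι (φ : A →ₗ[ℂ] ℂ) zero_le_one hbound
  have hπξ (a : A) : π a ξ = ι a := hι.eq_of_inner_left ℂ fun b => by
    rw [inner_map_left, hπι, hξ, hinner]
  refine ⟨H, _, _, _, π, ξ, hξ_norm, by simpa only [hπξ] using hι, ?_⟩
  refine DFunLike.ext _ _ fun a => ?_
  rw [vectorFunctional_apply, hπξ, hξ]
  rfl

end GNS

section Irreducibility

open scoped ComplexOrder InnerProductSpace CStarAlgebra

variable {A : Type*} [NonUnitalCStarAlgebra A] {H : Type*} [NormedAddCommGroup H]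
  [InnerProductSpace ℂ H] [CompleteSpace H] {π : A →⋆ₙₐ[ℂ] (H →L[ℂ] H)} {ξ : H}
  {M : Submodule ℂ H}

theorem mul_apply_eq_mul_apply_of_mem_extremePoints {φ ψ χ : WeakDual ℂ A} {s t : ℝ}
    (hφ : φ ∈ (quasiStates A).extremePoints ℝ) (hψ : ψ ∈ quasiStates A) (hχ : χ ∈ quasiStates A)
    (hs : 0 ≤ s) (ht : 0 ≤ t) (hst : s + t = 1) (h : ∀ a, φ a = s * ψ a + t * χ a) (a : A) :
    s * ψ a = s * φ a := by
  rcases hs.eq_or_lt with rfl | hs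
  · simp only [Complex.ofReal_zero, zero_mul]
  rcases ht.eq_or_lt with rfl | ht
  · obtain rfl : s = 1 := by rwa [add_zero] at hst
    rw [h, Complex.ofReal_one, Complex.ofReal_zero, zero_mul, add_zero, one_mul, one_mul]
  · rw [hφ.2 hψ hχ ⟨s, t, hs, ht, hst, DFunLike.ext _ _ fun b => (h b).symm⟩]

theorem map_eq_zero_of_vectorFunctional_mem {I : TwoSidedIdeal A}
    (hξ : DenseRange fun a => π a ξ) (hI : vectorFunctional π ξ ∈ quasiStatesVanishingOn I)
    {x : A} (hx : x ∈ I) : π x = 0 := by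
  have hzero (a : A) : π x (π a ξ) = 0 := by
    have h := hI.2 _ (I.mul_mem_left (star (x * a)) _ (I.mul_mem_right x a hx))
    rw [vectorFunctional_star_mul_self, map_mul, mul_apply_eq_comp] at h
    simpa using h
  exact DFunLike.coe_injective (hξ.equalizer (π x).continuous continuous_const (funext hzero))

theorem map_mem_orthogonal (hM : ∀ a, ∀ v ∈ M, π a v ∈ M) (a : A) {w : H} (hw : w ∈ Mᗮ) :
    π a w ∈ Mᗮ := fun v hv => by
  rw [← inner_map_star_left]
  exact hw _ (hM _ v hv)

theorem vectorFunctional_add_of_mem_orthogonal (hM : ∀ a, ∀ v ∈ M, π a v ∈ M) {v w : H}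
    (hv : v ∈ M) (hw : w ∈ Mᗮ) (a : A) :
    vectorFunctional π (v + w) a = vectorFunctional π v a + vectorFunctional π w a := by
  simp only [vectorFunctional_apply]
  rw [map_add, inner_add_left, inner_add_right, inner_add_right,
    Submodule.inner_right_of_mem_orthogonal hv (map_mem_orthogonal hM a hw),
    Submodule.inner_left_of_mem_orthogonal (hM a v hv) hw, add_zero, zero_add]

variable (π) in
theorem exists_vectorFunctional_eq_norm_sq_mul (v : H) :
    ∃ φ ∈ quasiStates A, ∀ a, vectorFunctional π v a = (‖v‖ ^ 2 : ℝ) * φ a := by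
  rcases eq_or_ne v 0 with rfl | hv
  · exact ⟨0, zero_mem_quasiStates, fun a => by simp [vectorFunctional_apply]⟩
  have hunit : ‖((‖v‖⁻¹ : ℝ) : ℂ) • v‖ ≤ 1 := by
    rw [Complex.ofReal_inv]
    exact (norm_smul_inv_norm (𝕜 := ℂ) hv).le
  refine ⟨_, vectorFunctional_mem_quasiStates π hunit, fun a => ?_⟩
  have hne : (‖v‖ : ℂ) ≠ 0 := Complex.ofReal_ne_zero.2 (norm_ne_zero_iff.2 hv)
  simp only [vectorFunctional_apply]
  rw [map_smul, inner_smul_left, inner_smul_right, Complex.conj_ofReal, Complex.ofReal_inv,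
    Complex.ofReal_pow]
  field_simp

theorem norm_eq_one_of_vectorFunctional_mem_extremePoints (hξ : ‖ξ‖ ≤ 1)
    (hext : vectorFunctional π ξ ∈ (quasiStates A).extremePoints ℝ)
    (hne : vectorFunctional π ξ ≠ 0) : ‖ξ‖ = 1 := by
  obtain ⟨φ, hφ, hφξ⟩ := exists_vectorFunctional_eq_norm_sq_mul π ξ
  have hsub : 0 ≤ 1 - ‖ξ‖ ^ 2 := sub_nonneg.2 (pow_le_one₀ (norm_nonneg ξ) hξ)
  have h := mul_apply_eq_mul_apply_of_mem_extremePoints hext zero_mem_quasiStates hφ hsub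
    (sq_nonneg ‖ξ‖) (sub_add_cancel _ _) fun a => by
      change _ = _ * 0 + _
      rw [mul_zero, zero_add, hφξ a]
  obtain ⟨a, ha⟩ := DFunLike.ne_iff.1 hne
  have hmul : ((1 - ‖ξ‖ ^ 2 : ℝ) : ℂ) * vectorFunctional π ξ a = 0 := (h a).symm.trans (mul_zero _)
  have hzero : 1 - ‖ξ‖ ^ 2 = 0 :=
    Complex.ofReal_eq_zero.1 ((mul_eq_zero.1 hmul).resolve_right ha)
  exact (pow_eq_one_iff_of_nonneg (norm_nonneg ξ) two_ne_zero).1 (sub_eq_zero.1 hzero).symm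

theorem vectorFunctional_eq_norm_sq_mul (hξ : ‖ξ‖ = 1)
    (hext : vectorFunctional π ξ ∈ (quasiStates A).extremePoints ℝ)
    (hM : ∀ a, ∀ v ∈ M, π a v ∈ M) {η ζ : H} (hη : η ∈ M) (hζ : ζ ∈ Mᗮ) (hadd : ξ = η + ζ) (a : A) :
    vectorFunctional π η a = (‖η‖ ^ 2 : ℝ) * vectorFunctional π ξ a := by
  obtain ⟨φ, hφ, hφη⟩ := exists_vectorFunctional_eq_norm_sq_mul π η
  obtain ⟨ψ, hψ, hψζ⟩ := exists_vectorFunctional_eq_norm_sq_mul π ζ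
  have hpyth : ‖η‖ ^ 2 + ‖ζ‖ ^ 2 = 1 := by
    rw [← one_pow 2, ← hξ, hadd, sq, sq, sq,
      norm_add_sq_eq_norm_sq_add_norm_sq_of_inner_eq_zero _ _ (hζ η hη)]
  rw [hφη]
  refine mul_apply_eq_mul_apply_of_mem_extremePoints hext hφ hψ (sq_nonneg _) (sq_nonneg _) hpyth
    (fun b => ?_) a
  rw [← hφη, ← hψζ, hadd, vectorFunctional_add_of_mem_orthogonal hM hη hζ]

theorem mem_or_mem_orthogonal_of_mem_extremePoints (hdense : DenseRange fun a => π a ξ)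
    (hξ : ‖ξ‖ = 1) (hext : vectorFunctional π ξ ∈ (quasiStates A).extremePoints ℝ)
    (hM : ∀ a, ∀ v ∈ M, π a v ∈ M) [M.HasOrthogonalProjection] : ξ ∈ M ∨ ξ ∈ Mᗮ := by
  obtain ⟨η, hη, ζ, hζ, hadd⟩ := M.exists_add_mem_mem_orthogonal ξ
  have hvec := vectorFunctional_eq_norm_sq_mul hξ hext hM hη hζ hadd
  have hη_eq : η = ((‖η‖ ^ 2 : ℝ) : ℂ) • ξ := hdense.eq_of_inner_right ℂ fun a => by
    calc ⟪π a ξ, η⟫_ℂ = ⟪ξ, π (star a) η⟫_ℂ := inner_map_left π a ξ η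
      _ = ⟪η, π (star a) η⟫_ℂ := by
        nth_rewrite 1 [hadd]
        rw [inner_add_left, Submodule.inner_left_of_mem_orthogonal (hM _ η hη) hζ, add_zero]
      _ = ((‖η‖ ^ 2 : ℝ) : ℂ) * ⟪ξ, π (star a) ξ⟫_ℂ := hvec (star a)
      _ = ⟪π a ξ, ((‖η‖ ^ 2 : ℝ) : ℂ) • ξ⟫_ℂ := by rw [inner_smul_right, inner_map_left]
  rcases eq_or_ne η 0 with rfl | hη0
  · exact .inr (by rwa [hadd, zero_add])
  · have hne : ((‖η‖ ^ 2 : ℝ) : ℂ) ≠ 0 := by exact_mod_cast pow_ne_zero 2 (norm_ne_zero_iff.2 hη0)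
    exact .inl ((M.smul_mem_iff hne).1 (hη_eq ▸ hη))

theorem eq_top_of_mem_of_denseRange (hdense : DenseRange fun a => π a ξ)
    (hMc : IsClosed (M : Set H)) (hM : ∀ a, ∀ v ∈ M, π a v ∈ M) (hξ : ξ ∈ M) : M = ⊤ :=
  eq_top_iff.2 fun v _ =>
    closure_minimal (Set.range_subset_iff.2 fun a => hM a ξ hξ) hMc (hdense v)

theorem isIrreducibleRep_of_mem_extremePoints (hdense : DenseRange fun a => π a ξ)
    (hξ : ‖ξ‖ ≤ 1) (hext : vectorFunctional π ξ ∈ (quasiStates A).extremePoints ℝ)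
    (hne : vectorFunctional π ξ ≠ 0) : IsIrreducibleRep π := by
  refine ⟨?_, fun M hMc hM => ?_⟩
  · rintro rfl
    exact hne (DFunLike.ext _ _ fun _ => inner_zero_right _)
  have : CompleteSpace M := hMc.completeSpace_coe
  have hξ1 := norm_eq_one_of_vectorFunctional_mem_extremePoints hξ hext hne
  rcases mem_or_mem_orthogonal_of_mem_extremePoints hdense hξ1 hext hM with hmem | hmem
  · exact .inr (eq_top_of_mem_of_denseRange hdense hMc hM hmem)
  · refine .inl (M.orthogonal_eq_top_iff.1 ?_)
    exact eq_top_of_mem_of_denseRange hdense M.isClosed_orthogonal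
      (fun a _ => map_mem_orthogonal hM a) hmem

end Irreducibility

section CosetNorm

variable {A : Type u} [NonUnitalCStarAlgebra A]

theorem cosetNorm_le_norm_add {a x : A} {I : TwoSidedIdeal A} (hx : x ∈ I) :
    cosetNorm a I ≤ ‖a + x‖ := by
  have hmk : (QuotientAddGroup.mk (a + x) : A ⧸ AddSubgroup.ofClass I) = QuotientAddGroup.mk a :=
    QuotientAddGroup.mk_add_of_mem a hx
  rw [cosetNorm, ← hmk]
  exact QuotientAddGroup.norm_mk_le_norm

theorem le_cosetNorm {a : A} {I : TwoSidedIdeal A} {r : ℝ} (h : ∀ x ∈ I, r ≤ ‖a + x‖) :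
    r ≤ cosetNorm a I := by
  refine le_of_forall_pos_le_add fun ε hε => ?_
  obtain ⟨x, hx, hlt⟩ := QuotientAddGroup.exists_norm_add_lt (AddSubgroup.ofClass I) a hε
  exact (h x hx).trans hlt.le

theorem cosetNorm_anti {I J : TwoSidedIdeal A} (h : I ≤ J) (a : A) :
    cosetNorm a J ≤ cosetNorm a I :=
  le_cosetNorm fun _ hx => cosetNorm_le_norm_add (h hx)

theorem cosetNorm_le_of_normExcess_mem {I : TwoSidedIdeal A} {a : A} {t : ℝ} (ht : 0 < t)
    (h : normExcess t a ∈ I) : cosetNorm a I ≤ t := by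
  refine (cosetNorm_le_norm_add (I.neg_mem h)).trans ?_
  rw [← sub_eq_add_neg]
  exact norm_sub_normExcess_le ht a

theorem cosetNorm_eq_norm_map {B : Type*} [NonUnitalCStarAlgebra B] (π : A →⋆ₙₐ[ℂ] B)
    {I : TwoSidedIdeal A} (hI : ∀ x, x ∈ I ↔ π x = 0) (a : A) : cosetNorm a I = ‖π a‖ := by
  refine le_antisymm (le_of_forall_gt_imp_ge_of_dense fun t ht => ?_) (le_cosetNorm fun x hx => ?_)
  · exact cosetNorm_le_of_normExcess_mem ((norm_nonneg _).trans_lt ht)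
      ((hI _).2 (map_normExcess_eq_zero π ((norm_nonneg _).trans_lt ht) ht.le))
  · have hle := NonUnitalStarAlgHom.norm_apply_le π (a + x)
    rwa [map_add, (hI x).1 hx, add_zero] at hle

theorem IsPrimitiveIdeal.normExcess_mem {P : TwoSidedIdeal A} (hP : IsPrimitiveIdeal P) {a : A}
    {t : ℝ} (ht : 0 < t) (ha : cosetNorm a P ≤ t) : normExcess t a ∈ P := by
  obtain ⟨H, _, _, _, π, -, hker⟩ := hP
  rw [cosetNorm_eq_norm_map π hker] at ha
  exact (hker _).2 (map_normExcess_eq_zero π ht ha)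

theorem cosetNorm_sInf_le {S : Set (TwoSidedIdeal A)} (hS : ∀ P ∈ S, IsPrimitiveIdeal P) {a : A}
    {t : ℝ} (ht : 0 < t) (ha : ∀ P ∈ S, cosetNorm a P ≤ t) : cosetNorm a (sInf S) ≤ t :=
  cosetNorm_le_of_normExcess_mem ht <| (TwoSidedIdeal.mem_sInf A).2 fun P hP =>
    (hS P hP).normExcess_mem ht (ha P hP)

theorem IsPrimitiveIdeal.exists_one_lt_cosetNorm {P : TwoSidedIdeal A}
    (hP : IsPrimitiveIdeal P) : ∃ a : A, 1 < cosetNorm a P := by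
  obtain ⟨H, _, _, _, π, hirr, hker⟩ := hP
  obtain ⟨a, ha⟩ : ∃ a, π a ≠ 0 := by
    by_contra! h
    exact hirr.1 (DFunLike.ext _ _ h)
  obtain ⟨c, hc⟩ := NormedField.exists_lt_norm ℂ ‖π a‖⁻¹
  refine ⟨c • a, ?_⟩
  rw [cosetNorm_eq_norm_map π hker, map_smul, norm_smul]
  exact (inv_lt_iff_one_lt_mul₀ (norm_pos_iff.2 ha)).1 hc

theorem IsPrimitiveIdeal.one_le_cosetNorm_star_mul_self_add {P : TwoSidedIdeal A}
    (hP : IsPrimitiveIdeal P) {a : A} (ha : 1 ≤ cosetNorm a P) (b : A) :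
    1 ≤ cosetNorm (star a * a + star b * b) P := by
  obtain ⟨H, _, _, _, π, -, hker⟩ := hP
  rw [cosetNorm_eq_norm_map π hker] at ha ⊢
  calc 1 ≤ ‖π a‖ * ‖π a‖ := one_le_mul_of_one_le_of_one_le ha ha
    _ = ‖star (π a) * π a‖ := CStarRing.norm_star_mul_self.symm
    _ ≤ ‖star (π a) * π a + star (π b) * π b‖ :=
      CStarAlgebra.norm_le_norm_of_nonneg_of_le (star_mul_self_nonneg _)
        (le_add_of_nonneg_right (star_mul_self_nonneg _))
    _ = ‖π (star a * a + star b * b)‖ := by simp only [map_add, map_mul, map_star]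

end CosetNorm

section PrimitiveIdealSpace

open Filter Topology

/-- The ideal of the elements that belong to `I i` for all `i` sufficiently far along `l`. When `l`
is an ultrafilter on primitive ideals, it converges to every primitive ideal above this one. -/
def eventualIdeal {R ι : Type*} [NonUnitalRing R] (l : Filter ι) (I : ι → TwoSidedIdeal R) :
    TwoSidedIdeal R :=
  .mk' {x | ∀ᶠ i in l, x ∈ I i} (.of_forall fun i => (I i).zero_mem)
    (fun hx hy => hx.mp (hy.mono fun i hyi hxi => (I i).add_mem hxi hyi))
    (fun hx => hx.mono fun i => (I i).neg_mem)
    (fun hy => hy.mono fun i => (I i).mul_mem_left _ _)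
    (fun hx => hx.mono fun i => (I i).mul_mem_right _ _)

theorem mem_eventualIdeal {R ι : Type*} [NonUnitalRing R] {l : Filter ι}
    {I : ι → TwoSidedIdeal R} {x : R} : x ∈ eventualIdeal l I ↔ ∀ᶠ i in l, x ∈ I i :=
  TwoSidedIdeal.mem_mk' ..

variable {A : Type u} [NonUnitalCStarAlgebra A]

theorem exists_tendsto_mem_quasiStatesVanishingOn_eventualIdeal {ι : Type*} (𝓤 : Ultrafilter ι)
    {I : ι → TwoSidedIdeal A} {φ : ι → WeakDual ℂ A}
    (hφ : ∀ i, φ i ∈ quasiStatesVanishingOn (I i)) :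
    ∃ ψ ∈ quasiStatesVanishingOn (eventualIdeal 𝓤 I), Tendsto φ 𝓤 (𝓝 ψ) := by
  obtain ⟨ψ, hψ, hlim⟩ := isCompact_quasiStates.ultrafilter_le_nhds (𝓤.map φ)
    (tendsto_principal.2 (.of_forall fun i => (hφ i).1))
  rw [Ultrafilter.coe_map] at hlim
  refine ⟨ψ, ⟨hψ, fun x hx => ?_⟩, hlim⟩
  exact tendsto_nhds_unique_of_eventuallyEq
    (((WeakDual.eval_continuous x).tendsto ψ).comp hlim) tendsto_const_nhds
    ((mem_eventualIdeal.1 hx).mono fun i hi => (hφ i).2 x hi)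

theorem IsPrimitiveIdeal.exists_cosetNorm_sq_le {P : TwoSidedIdeal A} (hP : IsPrimitiveIdeal P)
    (a : A) : ∃ φ ∈ quasiStatesVanishingOn P, cosetNorm a P ^ 2 ≤ (φ (star a * a)).re := by
  obtain ⟨H, _, _, _, π, -, hker⟩ := hP
  rw [cosetNorm_eq_norm_map π hker]
  exact exists_mem_quasiStatesVanishingOn_norm_sq_le π (fun x => (hker x).1) a

theorem exists_le_primSpace_re_le_cosetNorm_sq {I : TwoSidedIdeal A} {ψ : WeakDual ℂ A}
    (hψ : ψ ∈ quasiStatesVanishingOn I) {a : A} (hpos : 0 < (ψ (star a * a)).re) :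
    ∃ P : PrimSpace A, I ≤ P.1 ∧ (ψ (star a * a)).re ≤ cosetNorm a P.1 ^ 2 := by
  obtain ⟨φ, hext, hφI, hψφ⟩ := exists_mem_extremePoints_quasiStates hψ a
  obtain ⟨H, _, _, _, π, ξ, hξ, hdense, rfl⟩ := exists_cyclic_vectorFunctional_eq hext.1
  have hne : vectorFunctional π ξ ≠ 0 := fun h0 => by
    rw [h0] at hψφ
    exact hpos.not_ge hψφ
  have hker (x : A) : x ∈ TwoSidedIdeal.ker π ↔ π x = 0 := TwoSidedIdeal.mem_ker π
  refine ⟨⟨TwoSidedIdeal.ker π, H, _, _, _, π,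
    isIrreducibleRep_of_mem_extremePoints hdense hξ hext hne, hker⟩,
    fun x hx => (hker x).2 (map_eq_zero_of_vectorFunctional_mem hdense hφI hx), hψφ.trans ?_⟩
  rw [cosetNorm_eq_norm_map π hker, vectorFunctional_star_mul_self, Complex.ofReal_re]
  gcongr
  exact (π a).le_of_opNorm_le_of_le le_rfl hξ |>.trans_eq (mul_one _)

theorem isClosed_primSpace_iff {F : Set (PrimSpace A)} :
    IsClosed F ↔ ∃ I : TwoSidedIdeal A, idealHull I = F := by
  rw [← isOpen_compl_iff]
  change Fᶜᶜ ∈ Set.range idealHull ↔ _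
  rw [compl_compl, Set.mem_range]

theorem mem_of_isClosed_of_sInf_le {F : Set (PrimSpace A)} (hF : IsClosed F) {Q : PrimSpace A}
    (h : sInf {I | ∃ P ∈ F, P.1 = I} ≤ Q.1) : Q ∈ F := by
  obtain ⟨I, rfl⟩ := isClosed_primSpace_iff.1 hF
  refine le_trans (le_sInf ?_) h
  rintro _ ⟨P, hP, rfl⟩
  exact hP

theorem ultrafilter_le_nhds_of_eventualIdeal_le {𝓤 : Ultrafilter (PrimSpace A)} {P : PrimSpace A}
    (h : eventualIdeal 𝓤 (fun Q : PrimSpace A => Q.1) ≤ P.1) : ↑𝓤 ≤ 𝓝 P := by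
  refine le_nhds_iff.2 fun U hPU hU => ?_
  obtain ⟨I, hI⟩ := isClosed_primSpace_iff.1 hU.isClosed_compl
  have hIP : ¬I ≤ P.1 := fun hle => (hI ▸ hle : P ∈ Uᶜ) hPU
  obtain ⟨x, hxI, hx⟩ := Set.not_subset.1 fun hle => hIP (le_trans hle h)
  have hev : ∀ᶠ Q : PrimSpace A in 𝓤, x ∉ Q.1 :=
    Ultrafilter.eventually_not.2 fun hev => hx (mem_eventualIdeal.2 hev)
  refine hev.mono fun Q hQ => Set.notMem_compl_iff.1 fun hQU => hQ ?_
  exact (hI.symm ▸ hQU : Q ∈ idealHull I) hxI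

theorem isClosed_setOf_cosetNorm_le (a : A) {t : ℝ} (ht : 0 < t) :
    IsClosed {P : PrimSpace A | cosetNorm a P.1 ≤ t} := by
  refine isClosed_primSpace_iff.2
    ⟨sInf {I | IsPrimitiveIdeal I ∧ cosetNorm a I ≤ t},
      Set.ext fun Q => ⟨fun hQ => ?_, fun hQ => ?_⟩⟩
  · exact (cosetNorm_anti hQ a).trans (cosetNorm_sInf_le (fun I hI => hI.1) ht fun I hI => hI.2)
  · exact sInf_le (a := Q.1) ⟨Q.2, hQ⟩

theorem isCompact_setOf_le_cosetNorm (a : A) {β : ℝ} (hβ : 0 < β) :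
    IsCompact {P : PrimSpace A | β ≤ cosetNorm a P.1} := by
  refine isCompact_iff_ultrafilter_le_nhds.2 fun 𝓤 h𝓤 => ?_
  choose φ hφ hnorm using fun P : PrimSpace A => P.2.exists_cosetNorm_sq_le a
  obtain ⟨ψ, hψ, hlim⟩ := exists_tendsto_mem_quasiStatesVanishingOn_eventualIdeal 𝓤 hφ
  have hβψ : β ^ 2 ≤ (ψ (star a * a)).re :=
    ge_of_tendsto (((reEval (star a * a)).continuous.tendsto ψ).comp hlim) <|
      mem_of_superset (le_principal_iff.1 h𝓤) fun P hP =>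
        (pow_le_pow_left₀ hβ.le hP 2).trans (hnorm P)
  obtain ⟨P, hP, hψP⟩ := exists_le_primSpace_re_le_cosetNorm_sq hψ ((pow_pos hβ 2).trans_le hβψ)
  exact ⟨P, le_of_sq_le_sq (hβψ.trans hψP) (norm_nonneg _),
    ultrafilter_le_nhds_of_eventualIdeal_le hP⟩

theorem exists_one_le_cosetNorm_of_isCompact {C : Set (PrimSpace A)} (hC : IsCompact C) :
    ∃ a : A, ∀ P ∈ C, 1 ≤ cosetNorm a P.1 := by
  refine hC.induction_on (p := fun S => ∃ a : A, ∀ P ∈ S, 1 ≤ cosetNorm a P.1) ⟨0, by simp⟩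
    (fun S T hST ⟨a, ha⟩ => ⟨a, fun P hP => ha P (hST hP)⟩) ?_ fun P _ => ?_
  · rintro S T ⟨a, ha⟩ ⟨b, hb⟩
    refine ⟨star a * a + star b * b, ?_⟩
    rintro P (hP | hP)
    · exact P.2.one_le_cosetNorm_star_mul_self_add (ha P hP) b
    · rw [add_comm]
      exact P.2.one_le_cosetNorm_star_mul_self_add (hb P hP) a
  · obtain ⟨a, ha⟩ := P.2.exists_one_lt_cosetNorm
    have hopen : IsOpen {Q : PrimSpace A | 1 < cosetNorm a Q.1} := by
      have hcompl := (isClosed_setOf_cosetNorm_le a one_pos).isOpen_compl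
      simpa only [Set.compl_ofPred, not_le] using hcompl
    exact ⟨_, mem_nhdsWithin_of_mem_nhds (hopen.mem_nhds ha), a, fun Q hQ => le_of_lt hQ⟩

end PrimitiveIdealSpace

section GlimmSpace

variable {A : Type u} [NonUnitalCStarAlgebra A]

theorem isClosed_setOf_primEquiv (P : PrimSpace A) : IsClosed {Q | primEquiv P Q} := by
  simp only [primEquiv, Set.ofPred_forall]
  exact isClosed_iInter fun f => isClosed_eq continuous_const f.continuous

theorem glimmIdeal_le_iff {P Q : PrimSpace A} : glimmIdeal P ≤ Q.1 ↔ primEquiv P Q :=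
  ⟨mem_of_isClosed_of_sInf_le (isClosed_setOf_primEquiv P), fun h => sInf_le ⟨Q, h, rfl⟩⟩

theorem glimmIdeal_le (P : PrimSpace A) : glimmIdeal P ≤ P.1 :=
  glimmIdeal_le_iff.2 fun _ => rfl

theorem glimmMap_eq_iff {P Q : PrimSpace A} : glimmMap A P = glimmMap A Q ↔ primEquiv P Q := by
  refine ⟨fun h => ?_, fun h => ?_⟩
  · have heq : glimmIdeal P = glimmIdeal Q := congrArg Subtype.val h
    exact glimmIdeal_le_iff.1 (heq.trans_le (glimmIdeal_le Q))
  · have hiff (R : PrimSpace A) : primEquiv P R ↔ primEquiv Q R :=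
      forall_congr' fun f => by rw [h f]
    exact Subtype.ext (by simp only [glimmMap, glimmIdeal, hiff])

theorem glimmMap_surjective : Function.Surjective (glimmMap A) := by
  rintro ⟨_, P, rfl⟩
  exact ⟨P, rfl⟩

theorem continuous_glimmMap_tauCR : @Continuous _ _ _ (tauCR A) (glimmMap A) := by
  refine continuous_iInf_rng.2 fun g => continuous_iInf_rng.2 fun ⟨f, hf⟩ =>
    continuous_induced_rng.2 ?_
  exact f.continuous.congr fun P => (hf P).symm

theorem t2Space_tauCR : @T2Space (GlimmSpace A) (tauCR A) := by
  let := tauCR A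
  refine ⟨fun G₁ G₂ hne => ?_⟩
  obtain ⟨P, rfl⟩ := glimmMap_surjective G₁
  obtain ⟨Q, rfl⟩ := glimmMap_surjective G₂
  obtain ⟨f, hf⟩ := not_forall.1 (mt glimmMap_eq_iff.2 hne)
  let g : GlimmSpace A → ℝ := fun G => f (Function.surjInv glimmMap_surjective G)
  have hg (R : PrimSpace A) : g (glimmMap A R) = f R :=
    glimmMap_eq_iff.1 (Function.surjInv_eq glimmMap_surjective (glimmMap A R)) f
  have hcont : Continuous g :=
    continuous_iInf_dom (i := g) (continuous_iInf_dom (i := ⟨f, hg⟩) continuous_induced_dom)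
  exact separated_by_continuous hcont (by rwa [hg, hg])

theorem exists_primEquiv_lt_cosetNorm {a : A} {t : ℝ} (ht : 0 < t) {P : PrimSpace A}
    (h : t < cosetNorm a (glimmIdeal P)) : ∃ Q, primEquiv P Q ∧ t < cosetNorm a Q.1 := by
  by_contra! hcon
  refine h.not_ge (cosetNorm_sInf_le ?_ ht ?_)
  · rintro _ ⟨Q, -, rfl⟩
    exact Q.2
  · rintro _ ⟨Q, hQ, rfl⟩
    exact hcon Q hQ

theorem exists_isCompact_image_glimmMap_eq {K : Set (GlimmSpace A)}
    (hK : @IsCompact (GlimmSpace A) (tauCR A) K) {a : A} {α : ℝ} (hα : 0 < α)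
    (hKa : K ⊆ {G : GlimmSpace A | α ≤ cosetNorm a G.1}) :
    ∃ C : Set (PrimSpace A), IsCompact C ∧ glimmMap A '' C = K := by
  have hclosed : IsClosed (glimmMap A ⁻¹' K) :=
    @IsClosed.preimage _ _ _ (tauCR A) _ continuous_glimmMap_tauCR _
      (@IsCompact.isClosed _ (tauCR A) t2Space_tauCR _ hK)
  refine ⟨{P | α / 2 ≤ cosetNorm a P.1} ∩ glimmMap A ⁻¹' K,
    (isCompact_setOf_le_cosetNorm a (half_pos hα)).inter_right hclosed,
    Set.Subset.antisymm ?_ fun G hG => ?_⟩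
  · rintro _ ⟨P, hP, rfl⟩
    exact hP.2
  obtain ⟨P, rfl⟩ := glimmMap_surjective G
  have hαP := hKa hG
  rw [Set.mem_ofPred_eq] at hαP
  obtain ⟨Q, hPQ, hQ⟩ := exists_primEquiv_lt_cosetNorm (half_pos hα)
    ((half_lt_self hα).trans_le hαP)
  have heq : glimmMap A P = glimmMap A Q := glimmMap_eq_iff.2 hPQ
  exact ⟨Q, ⟨hQ.le, (heq ▸ hG : glimmMap A Q ∈ K)⟩, heq.symm⟩

theorem exists_image_glimmMap_subset_setOf_le_cosetNorm {C : Set (PrimSpace A)}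
    (hC : IsCompact C) :
    ∃ a : A, glimmMap A '' C ⊆ {G : GlimmSpace A | 1 ≤ cosetNorm a G.1} := by
  obtain ⟨a, ha⟩ := exists_one_le_cosetNorm_of_isCompact hC
  refine ⟨a, Set.image_subset_iff.2 fun P hP => ?_⟩
  exact (ha P hP).trans (cosetNorm_anti (glimmIdeal_le P) a)

end GlimmSpace

theorem mainTheorem3 {A : Type u} [NonUnitalCStarAlgebra A] (K : Set (GlimmSpace A))
    (hK : @IsCompact (GlimmSpace A) (tauCR A) K) :
    ((∃ a : A, ∃ α : ℝ, 0 < α ∧ K ⊆ {G : GlimmSpace A | α ≤ cosetNorm a G.1}) ↔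
      ∃ C : Set (PrimSpace A), IsCompact C ∧ glimmMap A '' C = K) ∧
    ((∃ a : A, ∃ α : ℝ, 0 < α ∧ K ⊆ {G : GlimmSpace A | α ≤ cosetNorm a G.1}) →
      @IsCompact (GlimmSpace A) (tauQ A) K) := by
  refine ⟨⟨?_, ?_⟩, ?_⟩
  · rintro ⟨a, α, hα, hKa⟩
    exact exists_isCompact_image_glimmMap_eq hK hα hKa
  · rintro ⟨C, hC, rfl⟩
    obtain ⟨a, ha⟩ := exists_image_glimmMap_subset_setOf_le_cosetNorm hC
    exact ⟨a, 1, one_pos, ha⟩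
  · rintro ⟨a, α, hα, hKa⟩
    obtain ⟨C, hC, rfl⟩ := exists_isCompact_image_glimmMap_eq hK hα hKa
    exact @IsCompact.image _ _ _ (tauQ A) _ _ hC continuous_coinduced_rng
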